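/- A randomized one-pass streaming algorithm with $M$ bits of memory over $[k]=\{1,\dots,k\}$ consists of a random initial memory content in $\{0,1\}^M$, a randomized, time-independent update rule that maps the current memory content and the element just read to a new memory content, and an accept/reject decision computed from the final memory content (so random bits that must be remembered, and any counter of the elements read, are part of the $M$ bits). Such an algorithm performs uniformity testing over $[k]$ with distance parameter $\varepsilon$ from a stream of $n$ samples if, on a stream of $n$ i.i.d. samples from an unknown distribution $p$ over $[k]$, it accepts with probability at least $2/3$ when $p$ is the uniform distribution $u_k$, and rejects with probability at least $2/3$ whenever $d_{TV}(p,u_k)=\frac12\sum_{i=1}^k|p(i)-1/k|>\varepsilon$. Theorem. There exist absolute constants $C',K>0$ and a randomized one-pass streaming algorithm which, on input $k\ge 1$, $\varepsilon\in(0,1]$, $n$ and $m$ (with $k,n,m$ integers), uses $$\max\left(m,\ \left\lceil K\log_2(k/\varepsilon)\right\rceil\right)$$ bits of memory and performs uniformity testing over $[k]$ with distance parameter $\varepsilon$ from a stream of $n$ samples, as long as $$n\ \ge\ C'\cdot\frac{k\sqrt{\log_2 n}}{\varepsilon^2\sqrt m}\qquad\text{and}\qquad \log_2 k\le m\le k\log_2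 n$$ (for $m=0$ the first condition is void). In particular, it uses at most $m$ bits whenever $m\ge K\log_2(k/\varepsilon)$, and $O(m)$ bits whenever $m\ge\max(\log_2 k,\log_2(1/\varepsilon))$. -/

import Mathlib

/-- A randomized one-pass streaming algorithm over the alphabet `α` with `M` bits of memory.
The whole memory content between two stream elements is a string of `M` bits; all random choices
that are to be remembered, and any counter of the elements read so far, are part of it (the update
rule `step` does not depend on time).  `init` is the law of the initial memory content,
`step x s` the law of the new memory content when element `x` is read with memory content `s`,
and `output s` the decision at the end of the stream (`true` is accept, `false` is reject). -/
structure StreamingAlgorithm (α : Type*) (M : ℕ) where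
  init : PMF (Fin M → Bool)
  step : α → (Fin M → Bool) → PMF (Fin M → Bool)
  output : (Fin M → Bool) → Bool

namespace StreamingAlgorithm

variable {α : Type*} {M : ℕ}

/-- The law of the memory content after reading the stream `xs`, in the order of the list. -/
noncomputable def memoryAfter (A : StreamingAlgorithm α M) (xs : List α) : PMF (Fin M → Bool) :=
  xs.foldl (fun μ x => μ.bind (A.step x)) A.init

/-- The law of the decision after reading the stream `xs`. -/
noncomputable def run (A : StreamingAlgorithm α M) (xs : List α) : PMF Bool :=
  (A.memoryAfter xs).map A.output

/-- The probability, over a stream of `n` independent samples from `p` and over the random choices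
of the algorithm, that the decision is `b`. -/
noncomputable def outputProb [Fintype α] (A : StreamingAlgorithm α M) (p : PMF α) (n : ℕ)
    (b : Bool) : ENNReal :=
  ∑ x : Fin n → α, (∏ i, p (x i)) * A.run (List.ofFn x) b

end StreamingAlgorithm

/-- Total variation distance between two distributions on a finite set. -/
noncomputable def tvDist {α : Type*} [Fintype α] (p q : PMF α) : ℝ :=
  (1 / 2) * ∑ i, |(p i).toReal - (q i).toReal|

/-- `A` performs uniformity testing over a domain of size `k` with distance parameter `ε` from a
stream of `n` independent samples. -/
def TestsUniformity {k M : ℕ} [NeZero k] (A : StreamingAlgorithm (Fin k) M) (n : ℕ) (ε : ℝ) :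
    Prop :=
  2 / 3 ≤ A.outputProb (PMF.uniformOfFintype (Fin k)) n true ∧
    ∀ p : PMF (Fin k), ε < tvDist p (PMF.uniformOfFintype (Fin k)) →
      2 / 3 ≤ A.outputProb p n false

/-!
The tester is a second-moment sketch of the deviation of the sample from uniformity. Read two
consecutive samples of size `N` and let `f`, `g : [k] → ℝ` be their histograms, each centred at
`N / k`. Since the two samples are independent, `⟨f, g⟩` has mean `N² D`, where `D = ‖p - u‖²` is
the squared `ℓ²` distance from the uniform distribution `u`; this is `0` for `p = u`, and
Cauchy-Schwarz gives `D ≥ 4 ε² / k` if `p` has total variation distance more than `ε` from `u`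
(`le_sqDist_of_lt_tvDist`). The histograms do not fit into the memory, so they are replaced by
linear sketches: for `B` independent random sign functions `h_b` on `[k]`, only the counters
`⟨h_b, f⟩` and `⟨h_b, g⟩` are kept, and the statistic is `∑_b ⟨h_b, f⟩ ⟨h_b, g⟩`, with mean
`B N² D`. Four-wise independence of the signs is enough to control the second moment over the
seeds, so that each sign function costs `O(log k)` bits (`exists_signFamily`) and each counter
`O(log N)` bits.

The variance of the statistic has a part from the sketch, `O(B (N + N² D)²)`, and a part from the
sample, `O(B² (N² (1 / k + D) + N³ (D / k + D^(3/2))))` (`jointMean_sketchStat_sub_sq_le`).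
Chebyshev's inequality at half the smallest mean of the far case then works once `B` exceeds a
constant, `N ε² ≳ √k` and `N ε² √B ≳ k` (`variance_le_of_far`, `exists_testsUniformity`).

For the parameters there are two regimes. If the stream has at least of order `k / ε²` elements,
then a constant `B` suffices; the tester uses only the first `O(k / ε²)` elements and ignores the
rest, so that seeds, counters and time fit into `O(log (k / ε))` bits however long the stream is.
Otherwise the hypothesis on `n` forces `m` to exceed a large multiple of `log n`; then `N = n / 2`
and `B` of order `m / log n` fit into `m` bits, and `n ≳ k √(log n) / (ε² √m)` says precisely that
`N ε² √B ≳ k`, while `m ≤ k log n` turns it into `N ε² ≳ √k`.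
-/

/-! ### Four-wise independent signs -/

/-- The nontrivial character of `ZMod 2`, with values `1` and `-1`. -/
def signChar (z : ZMod 2) : ℤ := if z = 0 then 1 else -1

lemma signChar_add (y z : ZMod 2) : signChar (y + z) = signChar y * signChar z := by
  revert y z; decide

lemma signChar_eq_or (z : ZMod 2) : signChar z = 1 ∨ signChar z = -1 := by
  revert z; decide

lemma sum_signChar_dual_eq_zero {V : Type*} [AddCommGroup V] [Module (ZMod 2) V]
    [Fintype (Module.Dual (ZMod 2) V)] {v : V} (hv : v ≠ 0) :
    ∑ s : Module.Dual (ZMod 2) V, signChar (s v) = 0 := by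
  obtain ⟨s₀, hs₀⟩ : ∃ s₀ : Module.Dual (ZMod 2) V, s₀ v ≠ 0 := by
    by_contra! h
    exact hv ((Module.forall_dual_apply_eq_zero_iff (ZMod 2) v).1 h)
  have h1 : signChar (s₀ v) = -1 := by simp [signChar, hs₀]
  have h2 : ∑ s : Module.Dual (ZMod 2) V, signChar (s v)
      = ∑ s : Module.Dual (ZMod 2) V, -signChar (s v) := by
    refine (Fintype.sum_equiv (Equiv.addRight s₀) _ _ fun s => ?_).symm
    simp [signChar_add, h1]
  rw [Finset.sum_neg_distrib] at h2
  omega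

/-- In characteristic two, the points `(x, x³)` form a Sidon set: the only vanishing sums of
four of them are the trivial ones. -/
lemma pairing_of_sum_eq_zero {F : Type*} [Field F] [CharP F 2] {a b c d : F}
    (h1 : a + b + c + d = 0) (h3 : a ^ 3 + b ^ 3 + c ^ 3 + d ^ 3 = 0) :
    (a = b ∧ c = d) ∨ (a = c ∧ b = d) ∨ (a = d ∧ b = c) := by
  have h2 : (2 : F) = 0 := CharTwo.two_eq_zero
  have hd : d = a + b + c := by linear_combination h1 - (a + b + c) * h2
  have hp : (a + b) * ((b + c) * (c + a)) = 0 := by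
    subst hd
    linear_combination h3 - (a^3+b^3+c^3 + (a + b) * ((b + c) * (c + a))) * h2
  rcases mul_eq_zero.1 hp with h | h
  · have hab : a = b := CharTwo.add_eq_zero.1 h
    left; refine ⟨hab, ?_⟩; rw [hd, h, zero_add]
  rcases mul_eq_zero.1 h with h | h
  · have hbc : b = c := CharTwo.add_eq_zero.1 h
    right; right; refine ⟨?_, hbc⟩; rw [hd, add_assoc, h, add_zero]
  · have hca : c = a := CharTwo.add_eq_zero.1 h
    right; left; refine ⟨hca.symm, ?_⟩; linear_combination -hd - h

/-- A family of sign functions, indexed by a finite set of seeds, whose values at any four points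
are uncorrelated unless the points cancel in pairs. -/
structure SignFamily (α : Type*) where
  Seed : Type
  [fintype : Fintype Seed]
  [nonempty : Nonempty Seed]
  sign : Seed → α → ℤ
  sign_eq_or : ∀ s a, sign s a = 1 ∨ sign s a = -1
  sum_eq_zero : ∀ a b c d, ¬ ((a = b ∧ c = d) ∨ (a = c ∧ b = d) ∨ (a = d ∧ b = c)) →
    ∑ s, sign s a * sign s b * sign s c * sign s d = 0

attribute [instance] SignFamily.fintype SignFamily.nonempty

/-- Over `k` points, `O(log k)` random bits are enough for four-wise independent signs: the seeds
are the linear functionals on `F × F`, where `F` is a field with `2 ^ r` elements and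
`k < 2 ^ r ≤ 2 * k`, and the point `x` of `F` receives the sign of the functional at `(x, x³)`. -/
lemma exists_signFamily (k : ℕ) (hk : k ≠ 0) :
    ∃ H : SignFamily (Fin k), Fintype.card H.Seed ≤ (2 * k) ^ 2 := by
  set r := Nat.log 2 k + 1 with hr
  have hr0 : r ≠ 0 := by omega
  have hkr : k ≤ 2 ^ r := (Nat.lt_pow_succ_log_self (by norm_num) k).le
  have hrk : 2 ^ r ≤ 2 * k := by
    have := Nat.pow_log_le_self 2 hk
    rw [hr, pow_succ]; omega
  have hcard : Nat.card (GaloisField 2 r) = 2 ^ r := GaloisField.card 2 r hr0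
  have : Fintype (GaloisField 2 r) := Fintype.ofFinite _
  obtain ⟨e⟩ : Nonempty (Fin k ↪ GaloisField 2 r) := by
    apply Function.Embedding.nonempty_of_card_le
    rw [Fintype.card_fin, ← Nat.card_eq_fintype_card, hcard]; exact hkr
  have : Finite (Module.Dual (ZMod 2) (GaloisField 2 r × GaloisField 2 r)) :=
    Module.finite_of_finite (ZMod 2)
  let _ : Fintype (Module.Dual (ZMod 2) (GaloisField 2 r × GaloisField 2 r)) := Fintype.ofFinite _
  refine ⟨{ Seed := Module.Dual (ZMod 2) (GaloisField 2 r × GaloisField 2 r)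
            sign := fun s a => signChar (s (e a, e a ^ 3))
            sign_eq_or := fun s a => signChar_eq_or _
            sum_eq_zero := ?_ }, ?_⟩
  · intro a b c d h
    simp only [← signChar_add, ← map_add]
    refine sum_signChar_dual_eq_zero fun h0 => h ?_
    have h1 := congrArg Prod.fst h0
    have h3 := congrArg Prod.snd h0
    simp only [Prod.fst_add, Prod.snd_add, Prod.fst_zero, Prod.snd_zero] at h1 h3
    simpa only [e.injective.eq_iff] using pairing_of_sum_eq_zero h1 h3
  · have h1 : Fintype.card (Module.Dual (ZMod 2) (GaloisField 2 r × GaloisField 2 r))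
        = Fintype.card (GaloisField 2 r × GaloisField 2 r) := by
      rw [Module.card_eq_pow_finrank (K := ZMod 2), Subspace.dual_finrank_eq,
        ← Module.card_eq_pow_finrank]
    rw [h1, Fintype.card_prod, ← Nat.card_eq_fintype_card, hcard, ← sq]
    exact Nat.pow_le_pow_left hrk 2

/-! ### Deterministic machines with a random start -/

/-- A machine with at most `2 ^ M` states, deterministic updates and a random initial state is a
streaming algorithm with `M` bits of memory. -/
lemma exists_algorithm_of_machine {α St : Type*} [Fintype St] {M : ℕ}
    (hcard : Fintype.card St ≤ 2 ^ M) (init : PMF St) (step : St → α → St) (out : St → Bool) :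
    ∃ A : StreamingAlgorithm α M, ∀ xs, A.run xs = init.map fun s => out (xs.foldl step s) := by
  obtain ⟨e⟩ : Nonempty (St ↪ (Fin M → Bool)) := by
    apply Function.Embedding.nonempty_of_card_le
    simpa using hcard
  have : Nonempty St := ⟨init.support_nonempty.some⟩
  have hdec : ∀ s, Function.invFun e (e s) = s := Function.leftInverse_invFun e.injective
  refine ⟨⟨init.map e, fun x y => PMF.pure (e (step (Function.invFun e y) x)),
    fun y => out (Function.invFun e y)⟩, fun xs => ?_⟩
  have key : ∀ (xs : List α) (μ : PMF St),
      xs.foldl (fun ν x => ν.bind fun y => PMF.pure (e (step (Function.invFun e y) x))) (μ.map e)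
        = μ.map fun s => e (xs.foldl step s) := by
    intro xs
    induction xs with
    | nil => intro μ; rfl
    | cons x xs ih =>
      intro μ
      rw [List.foldl_cons]
      have : ((μ.map e).bind fun y => PMF.pure (e (step (Function.invFun e y) x)))
          = (μ.map fun s => step s x).map e := by
        rw [PMF.bind_map, PMF.map_comp, PMF.map]
        congr 1
        funext s
        simp [hdec]
      rw [this, ih, PMF.map_comp]
      rfl
  simp only [StreamingAlgorithm.run, StreamingAlgorithm.memoryAfter]
  rw [key, PMF.map_comp]
  congr 1
  funext s
  simp [hdec]

/-! ### Expectations over independent samples -/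

/-- The expectation of `F` over a list of `n` independent samples with weights `p`. -/
noncomputable def iidMean {α : Type*} [Fintype α] (p : α → ℝ) (n : ℕ) (F : List α → ℝ) : ℝ :=
  ∑ x : Fin n → α, (∏ i, p (x i)) * F (List.ofFn x)

section iidMean

variable {α : Type*} [Fintype α] {p : α → ℝ} {n : ℕ} {F G : List α → ℝ}

lemma iidMean_zero : iidMean p 0 F = F [] := by simp [iidMean]

lemma iidMean_succ :
    iidMean p (n + 1) F = ∑ a, p a * iidMean p n fun l => F (a :: l) := by
  simp only [iidMean, Finset.mul_sum]
  rw [← Fintype.sum_prod_type' (f := fun (a : α) (x : Fin n → α) =>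
    p a * ((∏ i, p (x i)) * F (a :: List.ofFn x)))]
  refine (Fintype.sum_equiv (Fin.consEquiv fun _ => α) _ _ fun y => ?_).symm
  simp [Fin.prod_univ_succ, List.ofFn_succ, Fin.consEquiv, mul_assoc]

lemma iidMean_add_length (m n : ℕ) :
    iidMean p (m + n) F = iidMean p m fun l => iidMean p n fun l' => F (l ++ l') := by
  induction m generalizing F with
  | zero => simp [iidMean_zero]
  | succ m ih => rw [Nat.succ_add, iidMean_succ, iidMean_succ]; simp [ih]

lemma iidMean_congr (h : ∀ l : List α, l.length = n → F l = G l) :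
    iidMean p n F = iidMean p n G :=
  Finset.sum_congr rfl fun x _ => by rw [h _ (List.length_ofFn)]

lemma iidMean_mono (hp : ∀ a, 0 ≤ p a) (h : ∀ l : List α, l.length = n → F l ≤ G l) :
    iidMean p n F ≤ iidMean p n G :=
  Finset.sum_le_sum fun _ _ =>
    mul_le_mul_of_nonneg_left (h _ List.length_ofFn) (Finset.prod_nonneg fun _ _ => hp _)

lemma iidMean_add : iidMean p n (fun l => F l + G l) = iidMean p n F + iidMean p n G := by
  simp [iidMean, mul_add, Finset.sum_add_distrib]

lemma iidMean_const_mul (c : ℝ) : iidMean p n (fun l => c * F l) = c * iidMean p n F := by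
  simp only [iidMean, Finset.mul_sum]
  exact Finset.sum_congr rfl fun x _ => by ring

lemma iidMean_mul_const (c : ℝ) : iidMean p n (fun l => F l * c) = iidMean p n F * c := by
  simp only [mul_comm _ c, iidMean_const_mul]

lemma iidMean_sum {ι : Type*} (s : Finset ι) (f : ι → List α → ℝ) :
    iidMean p n (fun l => ∑ i ∈ s, f i l) = ∑ i ∈ s, iidMean p n (f i) := by
  simp only [iidMean, Finset.mul_sum]
  exact Finset.sum_comm

lemma iidMean_const (hp : ∑ a, p a = 1) (c : ℝ) : iidMean p n (fun _ => c) = c := by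
  induction n with
  | zero => exact iidMean_zero
  | succ n ih => rw [iidMean_succ]; simp [ih, ← Finset.sum_mul, hp]

lemma iidMean_sum_map (hp : ∑ a, p a = 1) (u : α → ℝ) :
    iidMean p n (fun l => (l.map u).sum) = n * ∑ a, p a * u a := by
  induction n with
  | zero => simp [iidMean_zero]
  | succ n ih =>
    rw [iidMean_succ]
    simp only [List.map_cons, List.sum_cons, iidMean_add, iidMean_const hp, ih, mul_add,
      Finset.sum_add_distrib, ← Finset.sum_mul, hp]
    push_cast
    ring

lemma iidMean_sum_map_mul_sum_map (hp : ∑ a, p a = 1) (u v : α → ℝ) :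
    iidMean p n (fun l => (l.map u).sum * (l.map v).sum)
      = n * ∑ a, p a * (u a * v a) + n * (n - 1) * ((∑ a, p a * u a) * ∑ a, p a * v a) := by
  induction n with
  | zero => simp [iidMean_zero]
  | succ n ih =>
    rw [iidMean_succ]
    have h : ∀ a, p a * iidMean p n (fun l => ((a :: l).map u).sum * ((a :: l).map v).sum)
        = p a * (u a * v a) + p a * u a * (n * ∑ a, p a * v a)
          + p a * v a * (n * ∑ a, p a * u a)
          + p a * (n * ∑ a, p a * (u a * v a)
            + n * (n - 1) * ((∑ a, p a * u a) * ∑ a, p a * v a)) := by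
      intro a
      simp only [List.map_cons, List.sum_cons, add_mul, mul_add, iidMean_add, iidMean_const hp,
        iidMean_const_mul, iidMean_mul_const, iidMean_sum_map hp, ih]
      ring
    simp only [h, Finset.sum_add_distrib, ← Finset.sum_mul, hp]
    push_cast
    ring

/-- The pointwise form of Chebyshev's inequality: if `I` is `1` whenever `T` is within `γ` of `μ`,
then integrating this bounds the mean of `I` below by `1 - E (T - μ) ^ 2 / γ ^ 2`. -/
lemma one_sub_le_indicator {I T μ γ : ℝ} (hγ : 0 < γ) (hI : 0 ≤ I) (h : |T - μ| < γ → I = 1) :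
    1 + -(1 / γ ^ 2) * (T - μ) ^ 2 ≤ I := by
  by_cases hT : |T - μ| < γ
  · rw [h hT]
    have : 0 ≤ 1 / γ ^ 2 * (T - μ) ^ 2 := by positivity
    linarith
  · have h1 : γ ^ 2 ≤ (T - μ) ^ 2 := by
      rw [← sq_abs (T - μ)]; exact pow_le_pow_left₀ hγ.le (not_lt.1 hT) 2
    have h2 : 1 ≤ 1 / γ ^ 2 * (T - μ) ^ 2 := by
      rw [one_div, inv_mul_eq_div, one_le_div (by positivity)]; exact h1
    linarith

end iidMean

/-! ### The sketch and its second moment -/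

section Sketch

open Finset

variable {α : Type*}

/-- The uniform weights on a finite type. -/
noncomputable def uniformWeight (S : Type*) [Fintype S] : S → ℝ := fun _ => (Fintype.card S : ℝ)⁻¹

lemma sum_uniformWeight (S : Type*) [Fintype S] [Nonempty S] : ∑ s, uniformWeight S s = 1 := by
  simp [uniformWeight]

lemma sum_uniformWeight_mul_sign_mul_sign [DecidableEq α] (H : SignFamily α) (a b : α) :
    ∑ s, uniformWeight H.Seed s * (H.sign s a * H.sign s b : ℝ) = if a = b then 1 else 0 := by
  simp only [uniformWeight, ← mul_sum]
  split_ifs with h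
  · subst h
    have h1 : ∀ s, (H.sign s a * H.sign s a : ℝ) = 1 := fun s => by
      rcases H.sign_eq_or s a with h | h <;> simp [h]
    simp [h1]
  · have h0 := H.sum_eq_zero a b a a (by simp [h, Ne.symm h])
    have h1 : ∀ s, H.sign s a * H.sign s b * H.sign s a * H.sign s a
        = H.sign s a * H.sign s b := fun s => by
      rcases H.sign_eq_or s a with h | h <;> simp [h]
    simp only [h1] at h0
    have h2 : ∑ s, (H.sign s a * H.sign s b : ℝ) = 0 := by exact_mod_cast h0
    rw [h2, mul_zero]

lemma sum_uniformWeight_mul_sign_four [DecidableEq α] (H : SignFamily α) (a b c d : α) :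
    ∑ s, uniformWeight H.Seed s * (H.sign s a * H.sign s b * H.sign s c * H.sign s d : ℝ)
      = (if a = b then 1 else 0) * (if c = d then 1 else 0)
        + (if a = c then 1 else 0) * (if b = d then 1 else 0)
        + (if a = d then 1 else 0) * (if b = c then 1 else 0)
        - 2 * ((if a = b then 1 else 0) * (if a = c then 1 else 0) * (if a = d then 1 else 0)) := by
  simp only [uniformWeight, ← mul_sum]
  by_cases h : (a = b ∧ c = d) ∨ (a = c ∧ b = d) ∨ (a = d ∧ b = c)
  · have h1 : ∀ s, (H.sign s a * H.sign s b * H.sign s c * H.sign s d : ℝ) = 1 := fun s => by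
      rcases h with ⟨rfl, rfl⟩ | ⟨rfl, rfl⟩ | ⟨rfl, rfl⟩
      · rcases H.sign_eq_or s a with h | h <;> rcases H.sign_eq_or s c with h' | h' <;>
          simp [h, h']
      all_goals
        rcases H.sign_eq_or s a with h | h <;> rcases H.sign_eq_or s b with h' | h' <;>
          simp [h, h']
    have h2 : ((Fintype.card H.Seed : ℝ))⁻¹ * ∑ s : H.Seed,
        (H.sign s a * H.sign s b * H.sign s c * H.sign s d : ℝ) = 1 := by simp [h1]
    rw [h2]
    rcases h with ⟨rfl, rfl⟩ | ⟨rfl, rfl⟩ | ⟨rfl, rfl⟩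
    · by_cases h : a = c <;> simp [h]; norm_num
    · by_cases h : a = b <;> simp [h]; norm_num
    · by_cases h : a = b <;> simp [h]; norm_num
  · have h0 : ∑ s, (H.sign s a * H.sign s b * H.sign s c * H.sign s d : ℝ) = 0 := by
      exact_mod_cast H.sum_eq_zero a b c d h
    rw [h0, mul_zero]
    split_ifs <;> simp_all

variable [Fintype α]

/-- The product of the sketches of two vectors by one random sign function. -/
def sketchProd (H : SignFamily α) (f g : α → ℝ) (s : H.Seed) : ℝ :=
  (∑ a, H.sign s a * f a) * ∑ a, H.sign s a * g a

lemma sum_uniformWeight_mul_sketchProd (H : SignFamily α) (f g : α → ℝ) :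
    ∑ s, uniformWeight H.Seed s * sketchProd H f g s = ∑ a, f a * g a := by
  classical
  have h : ∀ s, uniformWeight H.Seed s * sketchProd H f g s
      = ∑ a, ∑ b, f a * g b * (uniformWeight H.Seed s * (H.sign s a * H.sign s b)) := by
    intro s
    rw [sketchProd, sum_mul_sum, mul_sum]
    refine sum_congr rfl fun a _ => ?_
    rw [mul_sum]
    exact sum_congr rfl fun b _ => by ring
  simp only [h]
  rw [sum_comm]
  refine sum_congr rfl fun a _ => ?_
  rw [sum_comm]
  simp only [← mul_sum, sum_uniformWeight_mul_sign_mul_sign]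
  simp

lemma sum_uniformWeight_mul_sketchProd_sq_le (H : SignFamily α) (f g : α → ℝ) :
    ∑ s, uniformWeight H.Seed s * (sketchProd H f g s * sketchProd H f g s)
      ≤ 3 * ((∑ a, f a ^ 2) * ∑ a, g a ^ 2) := by
  classical
  have h : ∀ s, uniformWeight H.Seed s * (sketchProd H f g s * sketchProd H f g s)
      = ∑ a, ∑ b, ∑ c, ∑ d, f a * f b * g c * g d *
        (uniformWeight H.Seed s * (H.sign s a * H.sign s b * H.sign s c * H.sign s d)) := by
    intro s
    have : sketchProd H f g s * sketchProd H f g s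
        = (∑ a, H.sign s a * g a) * ((∑ a, H.sign s a * g a) *
          ((∑ a, H.sign s a * f a) * ∑ a, H.sign s a * f a)) := by
      rw [sketchProd]; ring
    rw [this]
    simp only [sum_mul, mul_sum]
    refine sum_congr rfl fun a _ => sum_congr rfl fun b _ => sum_congr rfl fun c _ =>
      sum_congr rfl fun d _ => by ring
  have h2 : ∑ s, uniformWeight H.Seed s * (sketchProd H f g s * sketchProd H f g s)
      = ∑ a, ∑ b, ∑ c, ∑ d, f a * f b * g c * g d *
        ∑ s, uniformWeight H.Seed s * (H.sign s a * H.sign s b * H.sign s c * H.sign s d) := by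
    simp only [h, mul_sum]
    rw [sum_comm]
    refine sum_congr rfl fun a _ => ?_
    rw [sum_comm]
    refine sum_congr rfl fun b _ => ?_
    rw [sum_comm]
    refine sum_congr rfl fun c _ => ?_
    rw [sum_comm]
  have h3 : ∑ s, uniformWeight H.Seed s * (sketchProd H f g s * sketchProd H f g s)
      = (∑ a, f a ^ 2) * (∑ a, g a ^ 2) + 2 * (∑ a, f a * g a) ^ 2
        - 2 * ∑ a, f a ^ 2 * g a ^ 2 := by
    rw [h2]
    simp only [sum_uniformWeight_mul_sign_four, mul_add, mul_sub, sum_add_distrib,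
      sum_sub_distrib, mul_ite, mul_one, mul_zero, sum_ite_eq, mem_univ, if_true,
      sum_const_zero, sum_ite_irrel]
    have e1 : ∑ a, ∑ c, f a * f a * g c * g c = (∑ a, f a ^ 2) * (∑ a, g a ^ 2) := by
      rw [sum_mul_sum]
      exact sum_congr rfl fun _ _ => sum_congr rfl fun _ _ => by ring
    have e2 : ∑ a, ∑ b, f a * f b * g a * g b = (∑ a, f a * g a) ^ 2 := by
      rw [sq, sum_mul_sum]
      exact sum_congr rfl fun _ _ => sum_congr rfl fun _ _ => by ring
    have e3 : ∑ a, ∑ b, f a * f b * g b * g a = (∑ a, f a * g a) ^ 2 := by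
      rw [sq, sum_mul_sum]
      exact sum_congr rfl fun _ _ => sum_congr rfl fun _ _ => by ring
    have e4 : ∑ a, f a * f a * g a * g a * 2 = 2 * ∑ a, f a ^ 2 * g a ^ 2 := by
      rw [mul_sum]
      exact sum_congr rfl fun _ _ => by ring
    rw [e1, e2, e3, e4]
    ring
  have h4 : 0 ≤ ∑ a, f a ^ 2 * g a ^ 2 := sum_nonneg fun a _ => by positivity
  have h5 := sum_mul_sq_le_sq_mul_sq univ f g
  rw [h3]
  linarith

/-- The sign function of a seed, centred so that its mean over the domain is zero. -/
noncomputable def centeredSign (H : SignFamily α) (s : H.Seed) (a : α) : ℝ :=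
  H.sign s a - (∑ b, (H.sign s b : ℝ)) / Fintype.card α

/-- The histogram of a list, centred at the histogram of a uniform sample of the same size. -/
noncomputable def excess [DecidableEq α] (l : List α) (a : α) : ℝ :=
  (l.map fun x => (if x = a then 1 else 0) - 1 / (Fintype.card α : ℝ)).sum

lemma sum_map_centeredSign [DecidableEq α] (H : SignFamily α) (s : H.Seed) (l : List α) :
    (l.map (centeredSign H s)).sum = ∑ a, H.sign s a * excess l a := by
  induction l with
  | nil => simp [excess]
  | cons x l ih =>
    have h : ∀ a, excess (x :: l) a
        = ((if x = a then 1 else 0) - 1 / (Fintype.card α : ℝ)) + excess l a := fun a => by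
      simp [excess]
    simp only [List.map_cons, List.sum_cons, ih, h, mul_add, sum_add_distrib, mul_sub,
      sum_sub_distrib, mul_ite, mul_one, mul_zero, sum_ite_eq, mem_univ, if_true, ← sum_mul]
    rw [centeredSign]
    ring

/-- The statistic of the tester: the sum over the seeds in `σ` of the product of the centred
sketches of the two halves `l`, `l'` of the sample. -/
noncomputable def sketchStat (H : SignFamily α) (l l' : List α) (σ : List H.Seed) : ℝ :=
  (σ.map fun s => (l.map (centeredSign H s)).sum * (l'.map (centeredSign H s)).sum).sum

lemma sketchStat_eq [DecidableEq α] (H : SignFamily α) (l l' : List α) (σ : List H.Seed) :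
    sketchStat H l l' σ = (σ.map (sketchProd H (excess l) (excess l'))).sum := by
  simp only [sketchStat, sum_map_centeredSign]
  rfl

lemma iidMean_sketchStat [DecidableEq α] (H : SignFamily α) (B : ℕ) (l l' : List α) :
    iidMean (uniformWeight H.Seed) B (sketchStat H l l')
      = B * ∑ a, excess l a * excess l' a := by
  have := iidMean_sum_map (n := B) (sum_uniformWeight H.Seed)
    (sketchProd H (excess l) (excess l'))
  rw [sum_uniformWeight_mul_sketchProd] at this
  rw [← this]
  simp only [← sketchStat_eq]

lemma iidMean_sketchStat_sq_le [DecidableEq α] (H : SignFamily α) (B : ℕ) (l l' : List α) :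
    iidMean (uniformWeight H.Seed) B (fun σ => sketchStat H l l' σ ^ 2)
      ≤ 3 * B * ((∑ a, excess l a ^ 2) * ∑ a, excess l' a ^ 2)
        + B ^ 2 * (∑ a, excess l a * excess l' a) ^ 2 := by
  have h := iidMean_sum_map_mul_sum_map (n := B) (sum_uniformWeight H.Seed)
    (sketchProd H (excess l) (excess l')) (sketchProd H (excess l) (excess l'))
  rw [sum_uniformWeight_mul_sketchProd] at h
  have hT : ∀ σ, sketchStat H l l' σ ^ 2
      = (σ.map (sketchProd H (excess l) (excess l'))).sum
        * (σ.map (sketchProd H (excess l) (excess l'))).sum := fun σ => by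
    rw [sketchStat_eq, sq]
  simp only [hT, h]
  have h1 := mul_le_mul_of_nonneg_left
    (sum_uniformWeight_mul_sketchProd_sq_le H (excess l) (excess l')) (Nat.cast_nonneg (α := ℝ) B)
  nlinarith [mul_nonneg (Nat.cast_nonneg (α := ℝ) B)
    (sq_nonneg (∑ a, excess l a * excess l' a))]

/-! ### Moments of the centred histogram -/

/-- The squared `ℓ²` distance of the weights `p` from the uniform distribution. -/
noncomputable def sqDist (p : α → ℝ) : ℝ := ∑ a, (p a - 1 / (Fintype.card α : ℝ)) ^ 2

lemma sum_sq_eq [Nonempty α] {p : α → ℝ} (hp1 : ∑ a, p a = 1) :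
    ∑ a, p a ^ 2 = 1 / (Fintype.card α : ℝ) + sqDist p := by
  have hk : (Fintype.card α : ℝ) ≠ 0 := by simp
  have : ∀ a, (p a - 1 / (Fintype.card α : ℝ)) ^ 2
      = p a ^ 2 - p a * (2 / (Fintype.card α : ℝ)) + 1 / (Fintype.card α : ℝ) ^ 2 := by
    intro a; ring
  simp only [sqDist, this, sum_add_distrib, sum_sub_distrib, ← sum_mul, hp1, sum_const,
    card_univ, nsmul_eq_mul]
  field_simp
  ring

variable [DecidableEq α] {p : α → ℝ}

lemma sum_mul_indicator_sub (hp1 : ∑ a, p a = 1) (a : α) :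
    ∑ x, p x * ((if x = a then 1 else 0) - 1 / (Fintype.card α : ℝ))
      = p a - 1 / (Fintype.card α : ℝ) := by
  simp only [mul_sub, sum_sub_distrib, ← sum_mul, hp1]
  simp

lemma iidMean_excess (hp1 : ∑ a, p a = 1) (N : ℕ) (a : α) :
    iidMean p N (fun l => excess l a) = N * (p a - 1 / (Fintype.card α : ℝ)) := by
  rw [← sum_mul_indicator_sub hp1 a, ← iidMean_sum_map hp1]
  rfl

lemma iidMean_excess_mul_excess (hp1 : ∑ a, p a = 1) (N : ℕ) (a b : α) :
    iidMean p N (fun l => excess l a * excess l b)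
      = N * ((if a = b then p a else 0) - p a * p b)
        + N ^ 2 * ((p a - 1 / (Fintype.card α : ℝ)) * (p b - 1 / (Fintype.card α : ℝ))) := by
  have h := iidMean_sum_map_mul_sum_map (n := N) hp1
    (fun x => (if x = a then 1 else 0) - 1 / (Fintype.card α : ℝ))
    (fun x => (if x = b then 1 else 0) - 1 / (Fintype.card α : ℝ))
  rw [sum_mul_indicator_sub hp1, sum_mul_indicator_sub hp1] at h
  have h2 : ∑ x, p x * (((if x = a then 1 else 0) - 1 / (Fintype.card α : ℝ)) *
        ((if x = b then 1 else 0) - 1 / (Fintype.card α : ℝ)))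
      = (if a = b then p a else 0) - p a / (Fintype.card α : ℝ) - p b / (Fintype.card α : ℝ)
        + 1 / (Fintype.card α : ℝ) ^ 2 := by
    have : ∀ x, p x * (((if x = a then 1 else 0) - 1 / (Fintype.card α : ℝ)) *
          ((if x = b then 1 else 0) - 1 / (Fintype.card α : ℝ)))
        = (if x = a then (if a = b then p a else 0) else 0)
          - (if x = a then p a / (Fintype.card α : ℝ) else 0)
          - (if x = b then p b / (Fintype.card α : ℝ) else 0)
          + p x * (1 / (Fintype.card α : ℝ) ^ 2) := by
      intro x
      by_cases h1 : x = a
      · subst h1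
        by_cases h2 : x = b
        · subst h2; simp; ring
        · simp [h2]; ring
      · by_cases h2 : x = b
        · subst h2; simp [h1]; ring
        · simp only [h1, h2, if_false]; ring
    simp only [this, sum_add_distrib, sum_sub_distrib, ← sum_mul, hp1, sum_ite_eq', mem_univ,
      if_true, one_mul]
  rw [h2] at h
  calc _ = _ := h
    _ = _ := by ring

lemma iidMean_sum_excess_sq_le (hp1 : ∑ a, p a = 1) (N : ℕ) :
    iidMean p N (fun l => ∑ a, excess l a ^ 2) ≤ N + N ^ 2 * sqDist p := by
  rw [iidMean_sum]
  simp only [sq (excess _ _), iidMean_excess_mul_excess hp1, if_true, sum_add_distrib, ← mul_sum,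
    sum_sub_distrib, hp1, sqDist, sq (p _ - _)]
  have : 0 ≤ ∑ a, p a * p a := sum_nonneg fun a _ => mul_self_nonneg _
  nlinarith [Nat.cast_nonneg (α := ℝ) N]

lemma iidMean_inner_excess (hp1 : ∑ a, p a = 1) (N : ℕ) :
    iidMean p N (fun l => iidMean p N fun l' => ∑ a, excess l a * excess l' a)
      = N ^ 2 * sqDist p := by
  simp only [iidMean_sum, iidMean_const_mul, iidMean_mul_const, iidMean_excess hp1, sqDist, mul_sum]
  exact sum_congr rfl fun a _ => by ring

lemma iidMean_inner_excess_sq (hp1 : ∑ a, p a = 1) (N : ℕ) :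
    iidMean p N (fun l => iidMean p N fun l' => (∑ a, excess l a * excess l' a) ^ 2)
      = ∑ a, ∑ b, (N * ((if a = b then p a else 0) - p a * p b)
        + N ^ 2 * ((p a - 1 / (Fintype.card α : ℝ)) * (p b - 1 / (Fintype.card α : ℝ)))) ^ 2 := by
  have h : ∀ l l' : List α, (∑ a, excess l a * excess l' a) ^ 2
      = ∑ a, ∑ b, (excess l a * excess l b) * (excess l' a * excess l' b) := by
    intro l l'
    rw [sq, sum_mul_sum]
    exact sum_congr rfl fun _ _ => sum_congr rfl fun _ _ => by ring
  simp only [h, iidMean_sum, iidMean_const_mul, iidMean_mul_const, iidMean_excess_mul_excess hp1,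
    sq (_ + _)]

lemma iidMean_inner_excess_sq_le [Nonempty α] (hp : ∀ a, 0 ≤ p a) (hp1 : ∑ a, p a = 1) (N : ℕ) :
    iidMean p N (fun l => iidMean p N fun l' => (∑ a, excess l a * excess l' a) ^ 2)
      ≤ 2 * N ^ 2 * (1 / (Fintype.card α : ℝ) + sqDist p)
        + 2 * N ^ 3 * (sqDist p / (Fintype.card α : ℝ) + sqDist p * √(sqDist p))
        + N ^ 4 * sqDist p ^ 2 := by
  rw [iidMean_inner_excess_sq hp1, ← sum_sq_eq hp1]
  set κ : ℝ := 1 / (Fintype.card α : ℝ) with hκ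
  have hexp : ∀ a b, (N * ((if a = b then p a else 0) - p a * p b)
        + N ^ 2 * ((p a - κ) * (p b - κ))) ^ 2
      = (if a = b then N ^ 2 * p a ^ 2 - 2 * N ^ 2 * p a ^ 3
          + 2 * N ^ 3 * (p a * (p a - κ) ^ 2) else 0)
        + N ^ 2 * (p a ^ 2 * p b ^ 2)
        - 2 * N ^ 3 * ((p a * (p a - κ)) * (p b * (p b - κ)))
        + N ^ 4 * ((p a - κ) ^ 2 * (p b - κ) ^ 2) := by
    intro a b
    by_cases h : a = b
    · subst h; simp; ring
    · simp [h]; ring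
  simp only [hexp, sum_add_distrib, sum_sub_distrib, sum_ite_eq, mem_univ, if_true, ← mul_sum,
    ← sum_mul]
  have hD : ∑ a, (p a - κ) ^ 2 = sqDist p := rfl
  rw [hD]
  have h2 : 0 ≤ ∑ a, p a ^ 2 := sum_nonneg fun a _ => sq_nonneg _
  have h2' : ∑ a, p a ^ 2 ≤ 1 := by
    rw [← hp1]
    refine sum_le_sum fun a _ => ?_
    have : p a ≤ 1 := by rw [← hp1]; exact single_le_sum (fun a _ => hp a) (mem_univ a)
    nlinarith [hp a]
  have h3 : 0 ≤ ∑ a, p a ^ 3 := sum_nonneg fun a _ => pow_nonneg (hp a) 3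
  have h4 : ∑ a, p a * (p a - κ) ^ 2
      ≤ sqDist p / (Fintype.card α : ℝ) + sqDist p * √(sqDist p) := by
    have h5 : ∀ a, p a * (p a - κ) ^ 2 ≤ (κ + √(sqDist p)) * (p a - κ) ^ 2 := by
      intro a
      refine mul_le_mul_of_nonneg_right ?_ (sq_nonneg _)
      have : p a - κ ≤ √(sqDist p) := by
        refine Real.le_sqrt_of_sq_le ?_
        rw [← hD]
        exact single_le_sum (f := fun a => (p a - κ) ^ 2) (fun a _ => sq_nonneg _) (mem_univ a)
      linarith
    calc _ ≤ _ := sum_le_sum fun a _ => h5 a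
      _ = _ := by rw [← mul_sum, hD, hκ]; ring
  have h6 : (∑ a, p a ^ 2) * (∑ a, p a ^ 2) ≤ ∑ a, p a ^ 2 := by nlinarith
  have h7 : 0 ≤ (∑ a, p a * (p a - κ)) * (∑ a, p a * (p a - κ)) := mul_self_nonneg _
  have hN : (0 : ℝ) ≤ N := Nat.cast_nonneg N
  have g3 : 0 ≤ 2 * (N : ℝ) ^ 2 * ∑ a, p a ^ 3 := by positivity
  have g4 := mul_le_mul_of_nonneg_left h4 (by positivity : 0 ≤ 2 * (N : ℝ) ^ 3)
  have g6 := mul_le_mul_of_nonneg_left h6 (by positivity : 0 ≤ (N : ℝ) ^ 2)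
  have g7 := mul_nonneg (by positivity : 0 ≤ 2 * (N : ℝ) ^ 3) h7
  linarith

/-- Expectation over two independent samples of size `N` and `B` independent seeds. -/
noncomputable def jointMean (H : SignFamily α) (p : α → ℝ) (N B : ℕ)
    (F : List α → List α → List H.Seed → ℝ) : ℝ :=
  iidMean p N fun l => iidMean p N fun l' => iidMean (uniformWeight H.Seed) B (F l l')

/-- The expectation of the statistic is `B * N ^ 2 * sqDist p`; this bounds its variance. -/
lemma jointMean_sketchStat_sub_sq_le [Nonempty α] (H : SignFamily α) (hp : ∀ a, 0 ≤ p a)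
    (hp1 : ∑ a, p a = 1) (N B : ℕ) :
    jointMean H p N B (fun l l' σ => (sketchStat H l l' σ - B * N ^ 2 * sqDist p) ^ 2)
      ≤ 3 * B * (N + N ^ 2 * sqDist p) ^ 2
        + B ^ 2 * (2 * N ^ 2 * (1 / (Fintype.card α : ℝ) + sqDist p)
          + 2 * N ^ 3 * (sqDist p / (Fintype.card α : ℝ) + sqDist p * √(sqDist p))) := by
  set μ : ℝ := B * N ^ 2 * sqDist p with hμ
  have hinner : ∀ l l' : List α,
      iidMean (uniformWeight H.Seed) B (fun σ => (sketchStat H l l' σ - μ) ^ 2)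
        ≤ 3 * B * ((∑ a, excess l a ^ 2) * ∑ a, excess l' a ^ 2)
          + (B ^ 2 * (∑ a, excess l a * excess l' a) ^ 2
            + (-(2 * μ * B) * (∑ a, excess l a * excess l' a) + μ ^ 2)) := by
    intro l l'
    have h : ∀ σ, (sketchStat H l l' σ - μ) ^ 2
        = sketchStat H l l' σ ^ 2 + (-(2 * μ) * sketchStat H l l' σ + μ ^ 2) := fun σ => by ring
    simp only [h]
    rw [iidMean_add, iidMean_add, iidMean_const_mul, iidMean_const (sum_uniformWeight _),
      iidMean_sketchStat]
    have := iidMean_sketchStat_sq_le H B l l'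
    linarith
  have hsum := iidMean_sum_excess_sq_le hp1 N
  have hsum0 : 0 ≤ iidMean p N (fun l => ∑ a, excess l a ^ 2) := by
    rw [← iidMean_const (n := N) hp1 0]
    exact iidMean_mono hp fun l _ => sum_nonneg fun a _ => sq_nonneg _
  have hsq := iidMean_inner_excess_sq_le hp hp1 N
  have hB : (0 : ℝ) ≤ B := Nat.cast_nonneg B
  calc _ ≤ iidMean p N fun l => iidMean p N fun l' =>
        3 * B * ((∑ a, excess l a ^ 2) * ∑ a, excess l' a ^ 2)
          + (B ^ 2 * (∑ a, excess l a * excess l' a) ^ 2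
            + (-(2 * μ * B) * (∑ a, excess l a * excess l' a) + μ ^ 2)) :=
        iidMean_mono hp fun l _ => iidMean_mono hp fun l' _ => hinner l l'
    _ = 3 * B * (iidMean p N (fun l => ∑ a, excess l a ^ 2)) ^ 2
        + (B ^ 2 * (iidMean p N fun l => iidMean p N fun l' =>
            (∑ a, excess l a * excess l' a) ^ 2) - μ ^ 2) := by
        simp only [iidMean_add, iidMean_const_mul, iidMean_mul_const, iidMean_const hp1,
          iidMean_inner_excess hp1]
        rw [hμ]
        ring
    _ ≤ _ := by
        have g1 := mul_le_mul_of_nonneg_left (pow_le_pow_left₀ hsum0 hsum 2)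
          (by positivity : 0 ≤ 3 * (B : ℝ))
        have g2 := mul_le_mul_of_nonneg_left hsq (by positivity : 0 ≤ (B : ℝ) ^ 2)
        rw [hμ]
        linarith

/-- Chebyshev's inequality: a decision with indicator `I` that is right whenever the statistic is
within `γ` of its mean is right with probability at least `2 / 3`. -/
lemma two_thirds_le_jointMean [Nonempty α] (H : SignFamily α) (hp : ∀ a, 0 ≤ p a)
    (hp1 : ∑ a, p a = 1) {N B : ℕ} {γ : ℝ} (hγ : 0 < γ) {I : List α → List α → List H.Seed → ℝ}
    (hI : ∀ l l' σ, 0 ≤ I l l' σ)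
    (h : ∀ l l' σ, |sketchStat H l l' σ - B * N ^ 2 * sqDist p| < γ → I l l' σ = 1)
    (hV : 3 * (3 * B * (N + N ^ 2 * sqDist p) ^ 2
        + B ^ 2 * (2 * N ^ 2 * (1 / (Fintype.card α : ℝ) + sqDist p)
          + 2 * N ^ 3 * (sqDist p / (Fintype.card α : ℝ) + sqDist p * √(sqDist p)))) ≤ γ ^ 2) :
    2 / 3 ≤ jointMean H p N B I := by
  have hq : ∀ s, 0 ≤ uniformWeight H.Seed s := fun s => by unfold uniformWeight; positivity
  have hvar := jointMean_sketchStat_sub_sq_le H hp hp1 N B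
  calc (2 / 3 : ℝ) ≤ 1 + -(1 / γ ^ 2) * jointMean H p N B
        (fun l l' σ => (sketchStat H l l' σ - B * N ^ 2 * sqDist p) ^ 2) := by
        have : 1 / γ ^ 2 * jointMean H p N B
            (fun l l' σ => (sketchStat H l l' σ - B * N ^ 2 * sqDist p) ^ 2) ≤ 1 / 3 := by
          rw [one_div, inv_mul_le_iff₀ (by positivity)]
          linarith
        linarith
    _ = jointMean H p N B fun l l' σ =>
          1 + -(1 / γ ^ 2) * (sketchStat H l l' σ - B * N ^ 2 * sqDist p) ^ 2 := by
        simp only [jointMean, iidMean_add, iidMean_const_mul, iidMean_const hp1,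
          iidMean_const (sum_uniformWeight _)]
    _ ≤ _ := iidMean_mono hp fun l _ => iidMean_mono hp fun l' _ => iidMean_mono hq fun σ _ =>
        one_sub_le_indicator hγ (hI l l' σ) (h l l' σ)

end Sketch

/-! ### The streaming implementation -/

section Machine

variable {α : Type*}

/-- The memory contents of the tester: the seeds, one counter per seed for each half of the
sample, and the time, which stops at `2 * N`. A counter has absolute value at most `N`, so that its
residue modulo `2 * N + 1` determines it. -/
abbrev SketchState (H : SignFamily α) (N B : ℕ) : Type :=
  (Fin B → H.Seed) × (Fin B → ZMod (2 * N + 1)) × (Fin B → ZMod (2 * N + 1)) × Fin (2 * N + 1)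

/-- The update: elements read at times in `[0, N)` go to the first counters, those read at times
in `[N, 2 * N)` go to the second counters, and later ones are ignored. -/
def sketchStep (H : SignFamily α) (N B : ℕ) (st : SketchState H N B) (x : α) :
    SketchState H N B :=
  if h : st.2.2.2.val < 2 * N then
    if st.2.2.2.val < N then
      (st.1, fun b => st.2.1 b + (H.sign (st.1 b) x : ZMod (2 * N + 1)), st.2.2.1,
        ⟨st.2.2.2.val + 1, by omega⟩)
    else
      (st.1, st.2.1, fun b => st.2.2.1 b + (H.sign (st.1 b) x : ZMod (2 * N + 1)),
        ⟨st.2.2.2.val + 1, by omega⟩)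
  else st

variable (H : SignFamily α) {N B : ℕ}

lemma foldl_sketchStep_first (σ : Fin B → H.Seed) (w : Fin B → ZMod (2 * N + 1)) (l : List α)
    (z : Fin B → ZMod (2 * N + 1)) (t : Fin (2 * N + 1)) (ht : t.val + l.length ≤ N) :
    ∃ t' : Fin (2 * N + 1), t'.val = t.val + l.length ∧
      l.foldl (sketchStep H N B) (σ, z, w, t)
        = (σ, fun b => z b + ((l.map (H.sign (σ b))).sum : ℤ), w, t') := by
  induction l generalizing z t with
  | nil => exact ⟨t, by simp, by simp⟩
  | cons x l ih =>
    rw [List.length_cons] at ht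
    obtain ⟨t', h1, h2⟩ := ih (fun b => z b + (H.sign (σ b) x : ZMod (2 * N + 1)))
      ⟨t.val + 1, by omega⟩ (by simp only; omega)
    refine ⟨t', by rw [h1, List.length_cons]; simp only; omega, ?_⟩
    rw [List.foldl_cons, sketchStep, dif_pos (by simp only; omega), if_pos (by simp only; omega)]
    rw [h2]
    simp [add_assoc]

lemma foldl_sketchStep_second (σ : Fin B → H.Seed) (z : Fin B → ZMod (2 * N + 1)) (l : List α)
    (w : Fin B → ZMod (2 * N + 1)) (t : Fin (2 * N + 1)) (hN : N ≤ t.val)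
    (ht : t.val + l.length ≤ 2 * N) :
    ∃ t' : Fin (2 * N + 1), t'.val = t.val + l.length ∧
      l.foldl (sketchStep H N B) (σ, z, w, t)
        = (σ, z, fun b => w b + ((l.map (H.sign (σ b))).sum : ℤ), t') := by
  induction l generalizing w t with
  | nil => exact ⟨t, by simp, by simp⟩
  | cons x l ih =>
    rw [List.length_cons] at ht
    obtain ⟨t', h1, h2⟩ := ih (fun b => w b + (H.sign (σ b) x : ZMod (2 * N + 1)))
      ⟨t.val + 1, by omega⟩ (by simp only; omega) (by simp only; omega)
    refine ⟨t', by rw [h1, List.length_cons]; simp only; omega, ?_⟩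
    rw [List.foldl_cons, sketchStep, dif_pos (by simp only; omega), if_neg (by simp only; omega)]
    rw [h2]
    simp [add_assoc]

lemma foldl_sketchStep_rest (st : SketchState H N B) (l : List α) (ht : st.2.2.2.val = 2 * N) :
    l.foldl (sketchStep H N B) st = st := by
  induction l with
  | nil => rfl
  | cons x l ih => rw [List.foldl_cons, sketchStep, dif_neg (by omega), ih]

lemma foldl_sketchStep (σ : Fin B → H.Seed) (l l' r : List α) (hl : l.length = N)
    (hl' : l'.length = N) :
    ∃ t' : Fin (2 * N + 1),
      (l ++ (l' ++ r)).foldl (sketchStep H N B) (σ, 0, 0, 0)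
        = (σ, fun b => (((l.map (H.sign (σ b))).sum : ℤ) : ZMod (2 * N + 1)),
            fun b => (((l'.map (H.sign (σ b))).sum : ℤ) : ZMod (2 * N + 1)), t') := by
  obtain ⟨t₁, h1, h2⟩ := foldl_sketchStep_first H σ 0 l 0 (0 : Fin (2 * N + 1)) (by simp [hl])
  obtain ⟨t₂, h3, h4⟩ := foldl_sketchStep_second H σ
    (fun b => (0 : Fin B → ZMod (2 * N + 1)) b + (((l.map (H.sign (σ b))).sum : ℤ) : ZMod _)) l' 0 t₁
    (by rw [h1, hl]; simp) (by rw [h1, hl, hl']; simp; omega)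
  refine ⟨t₂, ?_⟩
  rw [List.foldl_append, List.foldl_append, h2, h4, foldl_sketchStep_rest]
  · simp
  · simp only [h3, h1, hl, hl']; simp; omega

lemma abs_sum_map_sign_le (s : H.Seed) (l : List α) : |(l.map (H.sign s)).sum| ≤ l.length := by
  induction l with
  | nil => simp
  | cons x l ih =>
    have h : |H.sign s x| = 1 := by rcases H.sign_eq_or s x with h | h <;> simp [h]
    have := abs_add_le (H.sign s x) (l.map (H.sign s)).sum
    simp only [List.map_cons, List.sum_cons, List.length_cons]
    push_cast
    omega

lemma valMinAbs_sum_map_sign (s : H.Seed) (l : List α) (hl : l.length = N) :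
    (((l.map (H.sign s)).sum : ℤ) : ZMod (2 * N + 1)).valMinAbs = (l.map (H.sign s)).sum := by
  rw [ZMod.valMinAbs_spec]
  have h := abs_le.1 (abs_sum_map_sign_le H s l)
  rw [hl] at h
  refine ⟨rfl, ?_, ?_⟩ <;> push_cast <;> omega

variable [Fintype α]

/-- The statistic as a function of the final memory content. -/
noncomputable def stateStat (st : SketchState H N B) : ℝ :=
  ∑ b, ((st.2.1 b).valMinAbs - N * ((∑ a, (H.sign (st.1 b) a : ℝ)) / Fintype.card α))
    * ((st.2.2.1 b).valMinAbs - N * ((∑ a, (H.sign (st.1 b) a : ℝ)) / Fintype.card α))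

lemma sum_map_centeredSign_eq_sub (s : H.Seed) (l : List α) :
    (l.map (centeredSign H s)).sum = ((l.map (H.sign s)).sum : ℤ)
      - l.length * ((∑ a, (H.sign s a : ℝ)) / Fintype.card α) := by
  induction l with
  | nil => simp
  | cons x l ih =>
    simp only [List.map_cons, List.sum_cons, List.length_cons, ih, centeredSign]
    push_cast
    ring

lemma stateStat_foldl (σ : Fin B → H.Seed) (l l' r : List α) (hl : l.length = N)
    (hl' : l'.length = N) :
    stateStat H ((l ++ (l' ++ r)).foldl (sketchStep H N B) (σ, 0, 0, 0))
      = sketchStat H l l' (List.ofFn σ) := by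
  obtain ⟨t, ht⟩ := foldl_sketchStep H σ l l' r hl hl'
  rw [ht, stateStat, sketchStat, List.map_ofFn, List.sum_ofFn]
  refine Finset.sum_congr rfl fun b _ => ?_
  simp only [valMinAbs_sum_map_sign H _ l hl, valMinAbs_sum_map_sign H _ l' hl',
    Function.comp, sum_map_centeredSign_eq_sub, hl, hl']

/-- A decision whose law is that of a function of the stream and of `B` uniform seeds has
probabilities given by `iidMean`. -/
lemma toReal_outputProb {S : Type*} [Fintype S] [Nonempty S] {M : ℕ} (A : StreamingAlgorithm α M)
    (dec : List α → (Fin B → S) → Bool)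
    (hA : ∀ xs, A.run xs = (PMF.uniformOfFintype (Fin B → S)).map (dec xs))
    (p : PMF α) (n : ℕ) (c : Bool) (I : List α → List S → ℝ)
    (hI : ∀ xs σ, I xs (List.ofFn σ) = if dec xs σ = c then 1 else 0) :
    (A.outputProb p n c).toReal
      = iidMean (fun a => (p a).toReal) n fun xs => iidMean (uniformWeight S) B (I xs) := by
  rw [StreamingAlgorithm.outputProb, ENNReal.toReal_sum]
  · refine Finset.sum_congr rfl fun x _ => ?_
    rw [ENNReal.toReal_mul, ENNReal.toReal_prod, hA, PMF.map_apply, tsum_fintype,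
      ENNReal.toReal_sum]
    · congr 1
      refine Finset.sum_congr rfl fun σ _ => ?_
      rw [hI]
      by_cases h : dec (List.ofFn x) σ = c
      · simp [h, uniformWeight]
      · simp [h, Ne.symm h]
    · intro σ _
      split_ifs
      · exact PMF.apply_ne_top _ _
      · simp
  · intro x _
    exact ENNReal.mul_ne_top (ENNReal.prod_ne_top fun i _ => PMF.apply_ne_top _ _)
      (PMF.apply_ne_top _ _)

end Machine

/-! ### Correctness of the tester -/

section Tester

lemma sum_toReal_eq_one {α : Type*} [Fintype α] (p : PMF α) : ∑ a, (p a).toReal = 1 := by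
  rw [← ENNReal.toReal_sum fun a _ => PMF.apply_ne_top _ _, ← tsum_fintype (L := .unconditional _),
    p.tsum_coe, ENNReal.toReal_one]

lemma sqDist_uniform {α : Type*} [Fintype α] [Nonempty α] :
    sqDist (fun a => (PMF.uniformOfFintype α a).toReal) = 0 := by
  simp [sqDist]

lemma le_sqDist_of_lt_tvDist {α : Type*} [Fintype α] [Nonempty α] (p : PMF α) {ε : ℝ}
    (hε : 0 < ε) (h : ε < tvDist p (PMF.uniformOfFintype α)) :
    4 * ε ^ 2 / Fintype.card α ≤ sqDist fun a => (p a).toReal := by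
  have hk : (0 : ℝ) < Fintype.card α := by exact_mod_cast Fintype.card_pos
  have h1 : 2 * ε ≤ ∑ a, |(p a).toReal - 1 / (Fintype.card α : ℝ)| := by
    have : tvDist p (PMF.uniformOfFintype α)
        = (1 / 2) * ∑ a, |(p a).toReal - 1 / (Fintype.card α : ℝ)| := by simp [tvDist]
    linarith
  have h2 := sq_sum_le_card_mul_sum_sq (s := Finset.univ)
    (f := fun a => |(p a).toReal - 1 / (Fintype.card α : ℝ)|)
  simp only [sq_abs, Finset.card_univ] at h2
  rw [div_le_iff₀ hk]
  have h3 := pow_le_pow_left₀ (by positivity) h1 2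
  rw [sqDist]
  linarith

/-- The variance of the statistic is small against the square of its mean if the distribution is
far from uniform. -/
lemma variance_le_of_far {k N B ε D : ℝ} (hk : 1 ≤ k) (hN : 0 < N) (hε : 0 < ε) (hε1 : ε ≤ 1)
    (hB : 576 ≤ B) (h1 : 10000 * k ≤ N ^ 2 * ε ^ 4) (h2 : 36 * k ^ 2 ≤ N ^ 2 * ε ^ 4 * B)
    (hD : 4 * ε ^ 2 / k ≤ D) :
    3 * (3 * B * (N + N ^ 2 * D) ^ 2
        + B ^ 2 * (2 * N ^ 2 * (1 / k + D) + 2 * N ^ 3 * (D / k + D * √D)))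
      ≤ (B * N ^ 2 * D / 2) ^ 2 := by
  have hk0 : 0 < k := by linarith
  have hD0 : 0 < D := lt_of_lt_of_le (by positivity) hD
  have hDk : 4 * ε ^ 2 ≤ D * k := (div_le_iff₀ hk0).1 hD
  have hDk2 : 16 * ε ^ 4 ≤ D ^ 2 * k ^ 2 := by
    have := pow_le_pow_left₀ (by positivity) hDk 2
    nlinarith
  set w := √D with hw
  have hw0 : 0 < w := Real.sqrt_pos.2 hD0
  have hww : w ^ 2 = D := Real.sq_sqrt hD0.le
  have hb : 576 ≤ B * N ^ 2 * D ^ 2 := by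
    have : 576 * k ^ 2 ≤ (B * N ^ 2 * D ^ 2) * k ^ 2 := by
      have := mul_le_mul_of_nonneg_left hDk2 (by positivity : 0 ≤ B * N ^ 2)
      linarith
    exact le_of_mul_le_mul_right this (by positivity)
  have hc' : 160000 ≤ N ^ 2 * D ^ 2 * k := by
    have : 160000 * k ≤ (N ^ 2 * D ^ 2 * k) * k := by
      have := mul_le_mul_of_nonneg_left hDk2 (by positivity : 0 ≤ N ^ 2)
      linarith
    exact le_of_mul_le_mul_right this (by positivity)
  have hd : 40000 ≤ N ^ 2 * D := by
    have h4 : ε ^ 4 ≤ ε ^ 2 := pow_le_pow_of_le_one hε.le hε1 (by norm_num)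
    have : 40000 * k ≤ (N ^ 2 * D) * k := by
      have := mul_le_mul_of_nonneg_left hDk (by positivity : 0 ≤ N ^ 2)
      have := mul_le_mul_of_nonneg_left h4 (by positivity : 0 ≤ N ^ 2)
      linarith
    exact le_of_mul_le_mul_right this (by positivity)
  have he : 192 ≤ N * D * k := by
    refine (abs_le_of_sq_le_sq' ?_ (by positivity)).2
    have : (N * D * k) ^ 2 = (N ^ 2 * D ^ 2 * k) * k := by ring
    rw [this]
    nlinarith
  have hf : 192 ≤ N * w := by
    refine (abs_le_of_sq_le_sq' ?_ (by positivity)).2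
    rw [mul_pow, hww]
    linarith
  have ga : 576 * (B * N ^ 4 * D ^ 2) ≤ B ^ 2 * N ^ 4 * D ^ 2 := by
    have := mul_le_mul_of_nonneg_right hB (by positivity : 0 ≤ B * N ^ 4 * D ^ 2)
    linarith
  have gb : 576 * (B * N ^ 2) ≤ B ^ 2 * N ^ 4 * D ^ 2 := by
    have := mul_le_mul_of_nonneg_right hb (by positivity : 0 ≤ B * N ^ 2)
    linarith
  have gc : 192 * (B ^ 2 * N ^ 2 * (1 / k)) ≤ B ^ 2 * N ^ 4 * D ^ 2 := by
    have h3 := mul_le_mul_of_nonneg_right hc' (by positivity : 0 ≤ B ^ 2 * N ^ 2 * (1 / k))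
    have h4 : N ^ 2 * D ^ 2 * k * (B ^ 2 * N ^ 2 * (1 / k)) = B ^ 2 * N ^ 4 * D ^ 2 := by
      field_simp
    have : 0 ≤ B ^ 2 * N ^ 2 * (1 / k) := by positivity
    linarith
  have gd : 192 * (B ^ 2 * N ^ 2 * D) ≤ B ^ 2 * N ^ 4 * D ^ 2 := by
    have := mul_le_mul_of_nonneg_right hd (by positivity : 0 ≤ B ^ 2 * N ^ 2 * D)
    have : 0 ≤ B ^ 2 * N ^ 2 * D := by positivity
    linarith
  have ge : 192 * (B ^ 2 * N ^ 3 * (D / k)) ≤ B ^ 2 * N ^ 4 * D ^ 2 := by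
    have h3 := mul_le_mul_of_nonneg_right he (by positivity : 0 ≤ B ^ 2 * N ^ 3 * (D / k))
    have h4 : N * D * k * (B ^ 2 * N ^ 3 * (D / k)) = B ^ 2 * N ^ 4 * D ^ 2 := by
      field_simp
    linarith
  have gf : 192 * (B ^ 2 * N ^ 3 * (D * w)) ≤ B ^ 2 * N ^ 4 * D ^ 2 := by
    have h3 := mul_le_mul_of_nonneg_right hf (by positivity : 0 ≤ B ^ 2 * N ^ 3 * (D * w))
    have h4 : N * w * (B ^ 2 * N ^ 3 * (D * w)) = B ^ 2 * N ^ 4 * (D * w ^ 2) := by ring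
    rw [h4, hww] at h3
    linarith
  have g1 : (N + N ^ 2 * D) ^ 2 ≤ 2 * (N ^ 2 + N ^ 4 * D ^ 2) := by
    have := sq_nonneg (N - N ^ 2 * D)
    linarith
  have g2 := mul_le_mul_of_nonneg_left g1 (by positivity : 0 ≤ 3 * B)
  have g3 : 0 ≤ B ^ 2 * N ^ 4 * D ^ 2 := by positivity
  simp only [one_div, div_eq_mul_inv D k] at gc ge ⊢
  generalize k⁻¹ = κ at gc ge ⊢
  linarith

/-- The bound needed in the uniform case, where the mean is zero: the threshold is half the smallest
mean of the far case, and the variance increases with `D`. -/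
lemma variance_le_of_uniform {k N B ε : ℝ} (hk : 1 ≤ k) (hN : 0 < N) (hε : 0 < ε)
    (hε1 : ε ≤ 1) (hB : 576 ≤ B) (h1 : 10000 * k ≤ N ^ 2 * ε ^ 4)
    (h2 : 36 * k ^ 2 ≤ N ^ 2 * ε ^ 4 * B) :
    3 * (3 * B * (N + N ^ 2 * 0) ^ 2
        + B ^ 2 * (2 * N ^ 2 * (1 / k + 0) + 2 * N ^ 3 * (0 / k + 0 * √0)))
      ≤ (B * N ^ 2 * (4 * ε ^ 2 / k) / 2) ^ 2 := by
  refine le_trans ?_ (variance_le_of_far hk hN hε hε1 hB h1 h2 le_rfl)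
  have : 0 ≤ 4 * ε ^ 2 / k := by positivity
  gcongr

/-- The tester: it is correct on streams of at least `2 * N` samples if `N` and the number `B` of
seeds are large enough, and its memory holds the seeds, `2 * B` counters and the time. -/
lemma exists_testsUniformity (k : ℕ) [NeZero k] (H : SignFamily (Fin k)) {N B n M : ℕ} {ε : ℝ}
    (hε : 0 < ε) (hε1 : ε ≤ 1) (hn : 2 * N ≤ n)
    (hcard : Fintype.card H.Seed ^ B * (2 * N + 1) ^ (2 * B + 1) ≤ 2 ^ M)
    (hB : 576 ≤ B) (h1 : 10000 * (k : ℝ) ≤ (N : ℝ) ^ 2 * ε ^ 4)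
    (h2 : 36 * (k : ℝ) ^ 2 ≤ (N : ℝ) ^ 2 * ε ^ 4 * B) :
    ∃ A : StreamingAlgorithm (Fin k) M, TestsUniformity A n ε := by
  have hk : (1 : ℝ) ≤ k := by exact_mod_cast Nat.one_le_iff_ne_zero.2 (NeZero.ne k)
  have hN : (0 : ℝ) < N := by
    rcases Nat.eq_zero_or_pos N with h | h
    · subst h; norm_num at h1; linarith
    · exact_mod_cast h
  have hB' : (576 : ℝ) ≤ B := by exact_mod_cast hB
  set τ : ℝ := B * N ^ 2 * (4 * ε ^ 2 / k) / 2 with hτ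
  have hτ0 : 0 < τ := by positivity
  have hstates : Fintype.card (SketchState H N B) ≤ 2 ^ M := by
    simp only [SketchState, Fintype.card_prod, Fintype.card_fun, ZMod.card, Fintype.card_fin]
    calc _ = _ := by ring
      _ ≤ _ := hcard
  obtain ⟨A, hA⟩ := exists_algorithm_of_machine hstates
    ((PMF.uniformOfFintype (Fin B → H.Seed)).map fun σ => ((σ, 0, 0, 0) : SketchState H N B))
    (sketchStep H N B) fun st => decide (stateStat H st < τ)
  simp only [PMF.map_comp] at hA
  refine ⟨A, ?_⟩
  obtain ⟨r, rfl⟩ : ∃ r, n = N + (N + r) := ⟨n - 2 * N, by omega⟩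
  classical
  have key : ∀ (p : PMF (Fin k)) (c : Bool) (γ : ℝ), 0 < γ →
      (∀ T : ℝ, |T - B * N ^ 2 * sqDist (fun a => (p a).toReal)| < γ → decide (T < τ) = c) →
      3 * (3 * B * (N + N ^ 2 * sqDist fun a => (p a).toReal) ^ 2
        + B ^ 2 * (2 * N ^ 2 * (1 / (k : ℝ) + sqDist fun a => (p a).toReal)
          + 2 * N ^ 3 * ((sqDist fun a => (p a).toReal) / (k : ℝ)
            + (sqDist fun a => (p a).toReal) * √(sqDist fun a => (p a).toReal)))) ≤ γ ^ 2 →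
      2 / 3 ≤ A.outputProb p (N + (N + r)) c := by
    intro p c γ hγ hdec hV
    have hp1 := sum_toReal_eq_one p
    have hmean := two_thirds_le_jointMean H (p := fun a => (p a).toReal)
      (fun a => ENNReal.toReal_nonneg) hp1 (N := N) (B := B) hγ
      (I := fun l l' σ => if decide (sketchStat H l l' σ < τ) = c then 1 else 0)
      (fun l l' σ => by split_ifs <;> norm_num)
      (fun l l' σ h => by rw [if_pos (hdec _ h)])
      (by simpa only [Fintype.card_fin] using hV)
    -- Only lists of `B` seeds occur, so the value on other lists is irrelevant.
    have hprob : (A.outputProb p (N + (N + r)) c).toReal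
        = iidMean (fun a => (p a).toReal) (N + (N + r)) fun xs =>
          iidMean (uniformWeight H.Seed) B fun σ =>
            if h : σ.length = B then
              if decide (stateStat H (xs.foldl (sketchStep H N B)
                ((fun b => σ[b.val]'(by omega), 0, 0, 0) : SketchState H N B)) < τ) = c
              then 1 else 0
            else 0 :=
      toReal_outputProb A _ hA p _ c _ fun xs σ => by simp [Function.comp]
    have hlaw : (A.outputProb p (N + (N + r)) c).toReal
        = jointMean H (fun a => (p a).toReal) N B
          fun l l' σ => if decide (sketchStat H l l' σ < τ) = c then 1 else 0 := by
      rw [hprob, iidMean_add_length, jointMean]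
      refine iidMean_congr fun l hl => ?_
      rw [iidMean_add_length]
      refine iidMean_congr fun l' hl' => ?_
      rw [← iidMean_const (n := r) hp1 (iidMean (uniformWeight H.Seed) B _)]
      refine iidMean_congr fun l'' _ => ?_
      refine iidMean_congr fun σ hσ => ?_
      have hof : List.ofFn (fun b : Fin B => σ[b.val]'(by omega)) = σ := by
        subst hσ
        simp
      rw [dif_pos hσ, stateStat_foldl H _ l l' l'' hl hl', hof]
    rw [← hlaw] at hmean
    calc (2 / 3 : ENNReal) = ENNReal.ofReal (2 / 3) := by
          rw [ENNReal.ofReal_div_of_pos (by norm_num)]; norm_num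
      _ ≤ _ := ENNReal.ofReal_le_of_le_toReal hmean
  constructor
  · refine key _ true τ hτ0 ?_ ?_
    · intro T hT
      rw [sqDist_uniform, mul_zero, sub_zero] at hT
      exact decide_eq_true (lt_of_abs_lt hT)
    · rw [sqDist_uniform]
      exact variance_le_of_uniform hk hN hε hε1 hB' h1 h2
  · intro p hp
    have hD := le_sqDist_of_lt_tvDist p hε hp
    rw [Fintype.card_fin] at hD
    set D := sqDist fun a => (p a).toReal with hDdef
    have hD0 : 0 < D := lt_of_lt_of_le (by positivity) hD
    refine key p false (B * N ^ 2 * D / 2) (by positivity) ?_ ?_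
    · intro T hT
      have hle : τ ≤ B * N ^ 2 * D / 2 := by rw [hτ]; gcongr
      have := (abs_lt.1 hT).1
      exact decide_eq_false (by linarith)
    · exact variance_le_of_far hk hN hε hε1 hB' h1 h2 hD

end Tester

/-! ### Choice of the parameters -/

section Parameters

open Real

/-- If `x` bounds `2 * k` and `2 * N + 1`, then `5 * B * logb 2 x` bits are enough for the tester:
the seeds take `2 * B * logb 2 x` of them, and the counters and the time take the rest. -/
lemma exists_testsUniformity_of_le (k : ℕ) [NeZero k] {N B n M : ℕ} {ε x : ℝ}
    (hε : 0 < ε) (hε1 : ε ≤ 1) (hn : 2 * N ≤ n) (hkx : 2 * (k : ℝ) ≤ x) (hNx : 2 * (N : ℝ) + 1 ≤ x)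
    (hB : 576 ≤ B) (hM : 5 * B * logb 2 x ≤ M)
    (h1 : 10000 * (k : ℝ) ≤ (N : ℝ) ^ 2 * ε ^ 4)
    (h2 : 36 * (k : ℝ) ^ 2 ≤ (N : ℝ) ^ 2 * ε ^ 4 * B) :
    ∃ A : StreamingAlgorithm (Fin k) M, TestsUniformity A n ε := by
  obtain ⟨H, hH⟩ := exists_signFamily k (NeZero.ne k)
  refine exists_testsUniformity k H hε hε1 hn ?_ hB h1 h2
  have hx : 1 ≤ x := by linarith [Nat.cast_nonneg (α := ℝ) N]
  have hx0 : 0 < x := by linarith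
  have h3 : (Fintype.card H.Seed : ℝ) ≤ x ^ 2 := by
    calc (Fintype.card H.Seed : ℝ) ≤ (2 * (k : ℝ)) ^ 2 := by exact_mod_cast hH
      _ ≤ x ^ 2 := by gcongr
  have h4 : x ^ (5 * B) ≤ (2 : ℝ) ^ M := by
    have : x ^ (5 * B) = (2 : ℝ) ^ (5 * B * logb 2 x) := by
      rw [mul_comm (5 * (B : ℝ)), rpow_mul (by norm_num), rpow_logb (by norm_num) (by norm_num) hx0]
      exact_mod_cast (rpow_natCast x (5 * B)).symm
    rw [this, ← rpow_natCast 2 M]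
    exact rpow_le_rpow_of_exponent_le (by norm_num) hM
  have h5 : (Fintype.card H.Seed : ℝ) ^ B * (2 * (N : ℝ) + 1) ^ (2 * B + 1) ≤ 2 ^ M :=
    calc (Fintype.card H.Seed : ℝ) ^ B * (2 * (N : ℝ) + 1) ^ (2 * B + 1)
        ≤ (x ^ 2) ^ B * x ^ (2 * B + 1) := by gcongr
      _ = x ^ (2 * B + (2 * B + 1)) := by rw [← pow_mul, ← pow_add]
      _ ≤ x ^ (5 * B) := pow_le_pow_right₀ hx (by omega)
      _ ≤ 2 ^ M := h4
  exact_mod_cast h5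

/-- On a stream of order `k / ε ^ 2` samples, a bounded number of seeds is enough. -/
lemma exists_testsUniformity_of_long_stream (k : ℕ) [NeZero k] (hk : 2 ≤ k) {n M : ℕ} {ε : ℝ}
    (hε : 0 < ε) (hε1 : ε ≤ 1) (hn : 2 * ⌈100 * (k : ℝ) / ε ^ 2⌉₊ ≤ n)
    (hM : 30000 * logb 2 (k / ε) ≤ M) :
    ∃ A : StreamingAlgorithm (Fin k) M, TestsUniformity A n ε := by
  have hk' : (2 : ℝ) ≤ k := by exact_mod_cast hk
  set N := ⌈100 * (k : ℝ) / ε ^ 2⌉₊ with hNdef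
  have hN1 : 100 * (k : ℝ) / ε ^ 2 ≤ N := Nat.le_ceil _
  have hN2 : (N : ℝ) ≤ 100 * (k : ℝ) / ε ^ 2 + 1 :=
    (Nat.ceil_lt_add_one (by positivity)).le
  set y : ℝ := k / ε with hy
  have hky : (k : ℝ) ≤ y := by
    rw [hy, le_div_iff₀ hε]; nlinarith
  have hy2 : 2 ≤ y := hk'.trans hky
  have hkε : (k : ℝ) / ε ^ 2 ≤ y ^ 2 := by
    rw [hy, div_pow]; gcongr; nlinarith
  have hNε : 100 * (k : ℝ) ≤ N * ε ^ 2 := by rwa [div_le_iff₀ (by positivity)] at hN1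
  have hsq : 10000 * (k : ℝ) ^ 2 ≤ (N : ℝ) ^ 2 * ε ^ 4 := by
    have := pow_le_pow_left₀ (by positivity) hNε 2
    linarith
  have hy8 : (256 : ℝ) ≤ y ^ 8 := by
    have := pow_le_pow_left₀ (by norm_num) hy2 8
    linarith
  refine exists_testsUniformity_of_le k (B := 600) (x := y ^ 10) hε hε1 hn ?_ ?_ (by norm_num) ?_
    ?_ ?_
  · nlinarith [sq_nonneg y]
  · have e : 100 * (k : ℝ) / ε ^ 2 = 100 * (k / ε ^ 2) := by ring
    rw [e] at hN2
    nlinarith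
  · rw [logb_pow]
    push_cast
    linarith
  · nlinarith
  · push_cast
    nlinarith

/-- On shorter streams, the memory admits of order `m / logb 2 n` seeds. -/
lemma exists_testsUniformity_of_short_stream (k : ℕ) [NeZero k] (hk : 2 ≤ k) {n m M : ℕ} {ε : ℝ}
    (hε : 0 < ε) (hε1 : ε ≤ 1) (hn : n < 2 * ⌈100 * (k : ℝ) / ε ^ 2⌉₊)
    (hmM : m ≤ M) (hm : 1 ≤ m) (hmk : (m : ℝ) ≤ k * logb 2 n)
    (h : 20000 * (k * √(logb 2 n) / (ε ^ 2 * √m)) ≤ n) :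
    ∃ A : StreamingAlgorithm (Fin k) M, TestsUniformity A n ε := by
  have hk' : (2 : ℝ) ≤ k := by exact_mod_cast hk
  have hm' : (1 : ℝ) ≤ m := by exact_mod_cast hm
  set ℓ := logb 2 (n : ℝ) with hℓ
  have hℓ0 : 0 < ℓ := by
    by_contra! h0
    nlinarith
  have hn2 : 2 ≤ n := by
    by_contra! h0
    have : ℓ = 0 := by interval_cases n <;> simp [hℓ]
    linarith
  have hn2' : (2 : ℝ) ≤ n := by exact_mod_cast hn2
  have hsq : 20000 ^ 2 * (k : ℝ) ^ 2 * ℓ ≤ (n : ℝ) ^ 2 * ε ^ 4 * m := by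
    have h0 : 20000 * (k * √ℓ) ≤ n * (ε ^ 2 * √m) := by
      rwa [← mul_div_assoc, div_le_iff₀ (by positivity)] at h
    have := pow_le_pow_left₀ (by positivity) h0 2
    calc 20000 ^ 2 * (k : ℝ) ^ 2 * ℓ = (20000 * (k * √ℓ)) ^ 2 := by
          rw [mul_pow, mul_pow, sq_sqrt hℓ0.le]; ring
      _ ≤ _ := this
      _ = _ := by rw [mul_pow, mul_pow, sq_sqrt (by positivity)]; ring
  have hnup : (n : ℝ) * ε ^ 2 ≤ 202 * k := by
    have h1 : (⌈100 * (k : ℝ) / ε ^ 2⌉₊ : ℝ) < 100 * (k : ℝ) / ε ^ 2 + 1 :=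
      Nat.ceil_lt_add_one (by positivity)
    have h2 : (n : ℝ) < 2 * ⌈100 * (k : ℝ) / ε ^ 2⌉₊ := by exact_mod_cast hn
    have h3 : (n : ℝ) ≤ 2 * (100 * (k : ℝ) / ε ^ 2 + 1) := by linarith
    have h4 : 2 * (100 * (k : ℝ) / ε ^ 2 + 1) * ε ^ 2 = 200 * k + 2 * ε ^ 2 := by
      field_simp
      ring
    have h5 := mul_le_mul_of_nonneg_right h3 (sq_nonneg ε)
    nlinarith
  -- Since the stream is short, the memory is large compared to `ℓ`.
  have hmℓ : 6000 * ℓ ≤ m := by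
    have h1 := pow_le_pow_left₀ (by positivity) hnup 2
    have h2 : (n : ℝ) ^ 2 * ε ^ 4 * m ≤ (202 * k) ^ 2 * m := by
      have := mul_le_mul_of_nonneg_right h1 (by positivity : (0 : ℝ) ≤ m)
      linarith
    have h3 : (20000 ^ 2 * ℓ) * (k : ℝ) ^ 2 ≤ (202 ^ 2 * m) * (k : ℝ) ^ 2 := by linarith
    have h4 := le_of_mul_le_mul_right h3 (by positivity)
    linarith
  have hnk : 20000 ^ 2 * (k : ℝ) ≤ (n : ℝ) ^ 2 * ε ^ 4 := by
    have h1 := mul_le_mul_of_nonneg_left hmk (by positivity : (0 : ℝ) ≤ (n : ℝ) ^ 2 * ε ^ 4)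
    have h2 : (20000 ^ 2 * (k : ℝ)) * (k * ℓ) ≤ ((n : ℝ) ^ 2 * ε ^ 4) * (k * ℓ) := by linarith
    exact le_of_mul_le_mul_right h2 (by positivity)
  set B := ⌊(m : ℝ) / (10 * ℓ)⌋₊ with hBdef
  have hB600 : 600 ≤ B := by
    apply Nat.le_floor
    rw [le_div_iff₀ (by positivity)]
    push_cast
    linarith
  have hB1 : (B : ℝ) * (10 * ℓ) ≤ m :=
    (le_div_iff₀ (by positivity)).1 (Nat.floor_le (by positivity))
  have hB2 : (m : ℝ) ≤ B * (20 * ℓ) := by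
    have h1 : (m : ℝ) / (10 * ℓ) < B + 1 := Nat.lt_floor_add_one _
    rw [div_lt_iff₀ (by positivity)] at h1
    have h2 : (600 : ℝ) ≤ B := by exact_mod_cast hB600
    nlinarith
  set N := n / 2 with hNdef
  have hN1 : 2 * N ≤ n := by omega
  have hN2 : (n : ℝ) ≤ 4 * N := by exact_mod_cast (by omega : n ≤ 4 * N)
  have hN1' : 2 * (N : ℝ) ≤ n := by exact_mod_cast hN1
  have hNn : (n : ℝ) ^ 2 * ε ^ 4 ≤ 16 * ((N : ℝ) ^ 2 * ε ^ 4) := by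
    have := mul_le_mul_of_nonneg_right (pow_le_pow_left₀ (by positivity) hN2 2)
      (by positivity : (0 : ℝ) ≤ ε ^ 4)
    linarith
  have hε4 : ε ^ 4 ≤ 1 := pow_le_one₀ hε.le hε1
  refine exists_testsUniformity_of_le k (N := N) (B := B) (x := (n : ℝ) ^ 2) hε hε1 hN1 ?_ ?_
    (by omega) ?_ ?_ ?_
  · nlinarith [mul_le_mul_of_nonneg_left hε4 (sq_nonneg (n : ℝ))]
  · nlinarith
  · rw [logb_pow]
    have : (m : ℝ) ≤ M := by exact_mod_cast hmM
    push_cast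
    linarith
  · linarith
  · have h1 := mul_le_mul_of_nonneg_left hB2 (by positivity : (0 : ℝ) ≤ (n : ℝ) ^ 2 * ε ^ 4)
    have h2 : (20000 ^ 2 * (k : ℝ) ^ 2) * ℓ ≤ (20 * ((n : ℝ) ^ 2 * ε ^ 4 * B)) * ℓ := by linarith
    have h3 := le_of_mul_le_mul_right h2 hℓ0
    have h4 := mul_le_mul_of_nonneg_right hNn (Nat.cast_nonneg (α := ℝ) B)
    nlinarith

/-- Over a domain with one element, the only distribution is uniform, and one accepts. -/
lemma exists_testsUniformity_one (n M : ℕ) {ε : ℝ} (hε : 0 < ε) :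
    ∃ A : StreamingAlgorithm (Fin 1) M, TestsUniformity A n ε := by
  have huniq : ∀ p : PMF (Fin 1), p = PMF.uniformOfFintype (Fin 1) := by
    intro p
    ext a
    have h := p.tsum_coe
    rw [tsum_fintype, Fin.sum_univ_one] at h
    rw [Subsingleton.elim a 0, h]
    simp
  obtain ⟨A, hA⟩ := exists_algorithm_of_machine (α := Fin 1) (St := Unit) (M := M)
    (by simpa using Nat.one_le_two_pow) (PMF.pure ()) (fun st _ => st) fun _ => true
  refine ⟨A, ?_, fun p hp => ?_⟩
  · have : A.outputProb (PMF.uniformOfFintype (Fin 1)) n true = 1 := by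
      simp [StreamingAlgorithm.outputProb, hA, PMF.pure_map]
    rw [this]
    exact ENNReal.div_le_of_le_mul (by norm_num)
  · rw [huniq p] at hp
    simp [tvDist] at hp
    linarith

end Parameters

theorem theorem2 :
    ∃ C' : ℝ, 0 < C' ∧ ∃ K : ℝ, 0 < K ∧
      ∃ A : ∀ (k n m : ℕ) (ε : ℝ),
          StreamingAlgorithm (Fin k) (max m ⌈K * Real.logb 2 ((k : ℝ) / ε)⌉₊),
        ∀ (k n m : ℕ) [NeZero k] (ε : ℝ), 0 < ε → ε ≤ 1 →
          Real.logb 2 (k : ℝ) ≤ (m : ℝ) →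
          (m : ℝ) ≤ (k : ℝ) * Real.logb 2 (n : ℝ) →
          C' * ((k : ℝ) * Real.sqrt (Real.logb 2 (n : ℝ)) / (ε ^ 2 * Real.sqrt (m : ℝ))) ≤ (n : ℝ) →
          TestsUniformity (A k n m ε) n ε := by
  refine ⟨20000, by norm_num, 30000, by norm_num, ?_⟩
  have key : ∀ (k n m : ℕ) (ε : ℝ),
      ∃ A : StreamingAlgorithm (Fin k) (max m ⌈(30000 : ℝ) * Real.logb 2 ((k : ℝ) / ε)⌉₊),
        ∀ [NeZero k], 0 < ε → ε ≤ 1 →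
          Real.logb 2 (k : ℝ) ≤ (m : ℝ) →
          (m : ℝ) ≤ (k : ℝ) * Real.logb 2 (n : ℝ) →
          20000 * ((k : ℝ) * Real.sqrt (Real.logb 2 (n : ℝ)) / (ε ^ 2 * Real.sqrt (m : ℝ)))
            ≤ (n : ℝ) →
          TestsUniformity A n ε := by
    intro k n m ε
    by_cases hyp : k ≠ 0 ∧ 0 < ε ∧ ε ≤ 1 ∧ Real.logb 2 (k : ℝ) ≤ (m : ℝ) ∧
        (m : ℝ) ≤ (k : ℝ) * Real.logb 2 (n : ℝ) ∧
        20000 * ((k : ℝ) * Real.sqrt (Real.logb 2 (n : ℝ)) / (ε ^ 2 * Real.sqrt (m : ℝ))) ≤ (n : ℝ)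
    · obtain ⟨hk, hε, hε1, hkm, hmk, hn⟩ := hyp
      have : NeZero k := ⟨hk⟩
      suffices h : ∃ A : StreamingAlgorithm (Fin k)
          (max m ⌈(30000 : ℝ) * Real.logb 2 ((k : ℝ) / ε)⌉₊), TestsUniformity A n ε by
        obtain ⟨A, hA⟩ := h
        exact ⟨A, fun _ _ _ _ _ => hA⟩
      obtain rfl | hk2 : k = 1 ∨ 2 ≤ k := by omega
      · exact exists_testsUniformity_one n _ hε
      have hm : 1 ≤ m := by
        have h1 : (0 : ℝ) < Real.logb 2 k :=
          Real.logb_pos (by norm_num) (by exact_mod_cast hk2)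
        exact_mod_cast h1.trans_le hkm
      rcases le_or_gt (2 * ⌈100 * (k : ℝ) / ε ^ 2⌉₊) n with h | h
      · refine exists_testsUniformity_of_long_stream k hk2 hε hε1 h ((Nat.le_ceil _).trans ?_)
        exact_mod_cast le_max_right _ _
      · exact exists_testsUniformity_of_short_stream k hk2 hε hε1 h (le_max_left _ _) hm hmk hn
    · -- Outside the range of the parameters, any algorithm will do.
      refine ⟨⟨PMF.pure fun _ => false, fun _ => PMF.pure, fun _ => false⟩, ?_⟩
      intro hk hε hε1 hkm hmk hn
      exact absurd ⟨hk.ne, hε, hε1, hkm, hmk, hn⟩ hyp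
  choose A hA using key
  exact ⟨A, fun k n m _ ε => hA k n m ε⟩
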